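/- Let $E$ be a (real) Banach lattice and let $K$ be a compact Hausdorff space; let $C(K)$ denote the Banach lattice of continuous real-valued functions on $K$ with the pointwise order. Suppose that $E$ is order isomorphic to $C(K)$, i.e. there is a (not necessarily linear) bijection $T:E\to C(K)$ such that, for all $x,y\in E$, $x\ge y$ if and only if $Tx\ge Ty$. Then $E$ is lattice isomorphic to $C(K)$, i.e. there is a linear bijection $S:E\to C(K)$ such that $S|x|=|Sx|$ for all $x\in E$. -/

import Mathlib

/-!
The cofinal sequence of constant functions `n` in `C(K, ℝ)` pulls back to a countable cofinal set in
`E`, and completeness turns such a set into an order unit `u` (`exists_isOrderUnit`). It remains to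
produce, for each point `k`, a lattice homomorphism `E → ℝ` with value `1` at `u` out of the order
structure of `C(K, ℝ)` alone. The idea is Kaplansky's: the points of `K` are visible as prime ideals
of the lattice `C(K, ℝ)`.

Let `P` be a proper prime ideal of the lattice `E`, and let `C` be the set of those `d` with
`P + d ⊆ P`. Then `C` is closed under addition and suprema and contains the negative cone, and
primeness of `P` gives `x ∈ C` or `-x ∈ C` for every `x`, since `x ⊓ -x ≤ 0`. So `C` is the negative
cone of a total preorder on `E` compatible with addition, in which `u` is an order unit; measuring
elements against the multiples of `u` gives the lattice homomorphism `primeFunctional`.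

Given an order isomorphism `e` from `E` to `C(K, ℝ)`, each `k : K` and `t : ℝ` yield the prime ideal
of those `x` with `e x k ≤ t`. For fixed `k` these ideals form a chain, so they all define the same
functional (`primeFunctional_eq_of_subset`), called `pointFunctional`. If `e x k < e y k` then the
functional at `k` is at most as large at `x` as at `y`; from this follow the continuity in `k`
(`continuous_pointFunctional`) and the separation of points (`exists_pointFunctional_ne`). An element
at which all the functionals are positive is nonnegative
(`nonneg_of_forall_pointFunctional_pos`). Hence the resulting linear map `representation` from `E` to
`C(K, ℝ)` preserves and reflects the order, its range is complete, and the lattice form of the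
Stone–Weierstrass theorem makes it surjective.
-/

open Set

/-! ### The functional attached to a prime ideal of a vector lattice -/

section OrderUnit

variable {E : Type*}

/-- A proper prime ideal of the underlying lattice (linear structure plays no part), given as a
subset. -/
structure IsLatticePrime [Lattice E] (P : Set E) : Prop where
  lower {x y : E} : x ≤ y → y ∈ P → x ∈ P
  sup_mem {x y : E} : x ∈ P → y ∈ P → x ⊔ y ∈ P
  mem_or_mem {x y : E} : x ⊓ y ∈ P → x ∈ P ∨ y ∈ P
  nonempty : ∃ x, x ∈ P
  exists_notMem : ∃ x, x ∉ P

variable [AddCommGroup E]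

/-- The elements `d` by which `P` can be translated without leaving `P`. For a lattice prime `P`
this is the cone of nonpositive elements of a total preorder on `E` compatible with addition. -/
def translators (P : Set E) : Set E := {d | ∀ f ∈ P, f + d ∈ P}

variable {P Q : Set E} {u x y : E}

lemma add_mem_translators (hx : x ∈ translators P) (hy : y ∈ translators P) :
    x + y ∈ translators P := fun f hf => by
  rw [← add_assoc]; exact hy _ (hx f hf)

lemma nsmul_mem_translators (hx : x ∈ translators P) (n : ℕ) : n • x ∈ translators P := by
  induction n with
  | zero => intro f hf; simpa using hf
  | succ n ih => rw [succ_nsmul]; exact add_mem_translators ih hx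

variable [Lattice E] [IsOrderedAddMonoid E]

lemma translators_lower (hP : IsLatticePrime P) (h : x ≤ y) (hy : y ∈ translators P) :
    x ∈ translators P := fun f hf => hP.lower (by gcongr) (hy f hf)

lemma mem_translators_of_nonpos (hP : IsLatticePrime P) (h : x ≤ 0) : x ∈ translators P :=
  fun f hf => hP.lower (by simpa using h) hf

lemma sup_mem_translators (hP : IsLatticePrime P) (hx : x ∈ translators P)
    (hy : y ∈ translators P) : x ⊔ y ∈ translators P := fun f hf => by
  rw [add_sup]; exact hP.sup_mem (hx f hf) (hy f hf)

/-- Primeness makes the preorder total, because `x ⊓ -x ≤ 0`. -/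
lemma mem_translators_or_neg_mem (hP : IsLatticePrime P) (x : E) :
    x ∈ translators P ∨ -x ∈ translators P := by
  by_contra! h
  obtain ⟨h1, h2⟩ := h
  simp only [translators, mem_ofPred_eq, not_forall] at h1 h2
  obtain ⟨f, hf, hfx⟩ := h1
  obtain ⟨g, hg, hgx⟩ := h2
  have hinf : x ⊓ -x ≤ 0 := by
    rw [← neg_nonneg, neg_inf, neg_neg, sup_comm]
    exact abs_nonneg x
  have hmem : (f ⊔ g + x) ⊓ (f ⊔ g + -x) ∈ P := by
    rw [← add_inf]
    exact mem_translators_of_nonpos hP hinf _ (hP.sup_mem hf hg)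
  rcases hP.mem_or_mem hmem with h | h
  · exact hfx (hP.lower (by gcongr; exact le_sup_left) h)
  · exact hgx (hP.lower (by gcongr; exact le_sup_right) h)

variable [Module ℝ E]

/-- An order unit of a vector lattice: a positive element whose multiples are cofinal. -/
structure IsOrderUnit (u : E) : Prop where
  nonneg : 0 ≤ u
  exists_le (x : E) : ∃ c : ℝ, x ≤ c • u

/-- The value at `x` of the functional attached to `P`, normalised to be `1` at `u`: the infimum of
those `s` for which `x` is below `s • u` in the total preorder defined by `translators P`. -/
noncomputable def primeValue (P : Set E) (u x : E) : ℝ := sInf {s : ℝ | x - s • u ∈ translators P}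

lemma nonempty_primeValue (hP : IsLatticePrime P) (hu : IsOrderUnit u) (x : E) :
    {s : ℝ | x - s • u ∈ translators P}.Nonempty := by
  obtain ⟨c, hc⟩ := hu.exists_le x
  exact ⟨c, mem_translators_of_nonpos hP (sub_nonpos.2 hc)⟩

variable [IsOrderedModule ℝ E]

lemma IsOrderUnit.exists_abs_le (hu : IsOrderUnit u) (x : E) : ∃ c : ℝ, 0 ≤ c ∧ |x| ≤ c • u := by
  obtain ⟨c, hc⟩ := hu.exists_le |x|
  exact ⟨|c|, abs_nonneg c, hc.trans (smul_le_smul_of_nonneg_right (le_abs_self c) hu.nonneg)⟩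

lemma smul_unit_notMem_translators (hP : IsLatticePrime P) (hu : IsOrderUnit u) {r : ℝ}
    (hr : 0 < r) : r • u ∉ translators P := by
  intro h
  obtain ⟨f, hf⟩ := hP.nonempty
  obtain ⟨g, hg⟩ := hP.exists_notMem
  obtain ⟨c, hc⟩ := hu.exists_le (g - f)
  obtain ⟨n, hn⟩ := exists_nat_ge (c / r)
  refine hg (hP.lower ?_ (nsmul_mem_translators h n f hf))
  rw [← sub_le_iff_le_add', ← Nat.cast_smul_eq_nsmul ℝ, smul_smul]
  exact hc.trans (smul_le_smul_of_nonneg_right ((div_le_iff₀ hr).1 hn) hu.nonneg)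

lemma le_of_mem_translators (hP : IsLatticePrime P) (hu : IsOrderUnit u) {s t : ℝ}
    (hs : s • u - x ∈ translators P) (ht : x - t • u ∈ translators P) : s ≤ t := by
  by_contra! h
  refine smul_unit_notMem_translators hP hu (sub_pos.2 h) ?_
  have := add_mem_translators hs ht
  rwa [sub_add_sub_cancel, ← sub_smul] at this

lemma bddBelow_primeValue (hP : IsLatticePrime P) (hu : IsOrderUnit u) (x : E) :
    BddBelow {s : ℝ | x - s • u ∈ translators P} := by
  obtain ⟨c, -, hc⟩ := hu.exists_abs_le x
  refine ⟨-c, fun s hs => le_of_mem_translators hP hu ?_ hs⟩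
  refine mem_translators_of_nonpos hP ?_
  rw [neg_smul, sub_nonpos, neg_le]
  exact (neg_le_abs x).trans hc

lemma primeValue_le (hP : IsLatticePrime P) (hu : IsOrderUnit u) {s : ℝ}
    (h : x - s • u ∈ translators P) : primeValue P u x ≤ s :=
  csInf_le (bddBelow_primeValue hP hu x) h

lemma le_primeValue (hP : IsLatticePrime P) (hu : IsOrderUnit u) {s : ℝ}
    (h : s • u - x ∈ translators P) : s ≤ primeValue P u x :=
  le_csInf (nonempty_primeValue hP hu x) fun _ ht => le_of_mem_translators hP hu h ht

lemma mem_translators_of_primeValue_lt (hP : IsLatticePrime P) (hu : IsOrderUnit u) {s : ℝ}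
    (h : primeValue P u x < s) : x - s • u ∈ translators P := by
  obtain ⟨t, ht, hts⟩ := exists_lt_of_csInf_lt (nonempty_primeValue hP hu x) h
  exact translators_lower hP (sub_le_sub_left (smul_le_smul_of_nonneg_right hts.le hu.nonneg) x) ht

lemma mem_translators_of_lt_primeValue (hP : IsLatticePrime P) (hu : IsOrderUnit u) {s : ℝ}
    (h : s < primeValue P u x) : s • u - x ∈ translators P := by
  rcases mem_translators_or_neg_mem hP (s • u - x) with h' | h'
  · exact h'
  · rw [neg_sub] at h'
    exact absurd (primeValue_le hP hu h') h.not_ge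

lemma primeValue_add (hP : IsLatticePrime P) (hu : IsOrderUnit u) (x y : E) :
    primeValue P u (x + y) = primeValue P u x + primeValue P u y := by
  refine le_antisymm (le_of_forall_pos_le_add fun ε hε => ?_)
    (le_of_forall_pos_le_add fun ε hε => ?_)
  · have h1 := mem_translators_of_primeValue_lt hP hu (lt_add_of_pos_right _ (half_pos hε) :
      primeValue P u x < primeValue P u x + ε / 2)
    have h2 := mem_translators_of_primeValue_lt hP hu (lt_add_of_pos_right _ (half_pos hε) :
      primeValue P u y < primeValue P u y + ε / 2)
    have h3 := add_mem_translators h1 h2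
    rw [sub_add_sub_comm, ← add_smul] at h3
    have := primeValue_le hP hu h3
    linarith
  · have h1 := mem_translators_of_lt_primeValue hP hu (sub_lt_self _ (half_pos hε) :
      primeValue P u x - ε / 2 < primeValue P u x)
    have h2 := mem_translators_of_lt_primeValue hP hu (sub_lt_self _ (half_pos hε) :
      primeValue P u y - ε / 2 < primeValue P u y)
    have h3 := add_mem_translators h1 h2
    rw [sub_add_sub_comm, ← add_smul] at h3
    have := le_primeValue hP hu h3
    linarith

lemma primeValue_mono (hP : IsLatticePrime P) (hu : IsOrderUnit u) (h : x ≤ y) :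
    primeValue P u x ≤ primeValue P u y :=
  le_of_forall_gt_imp_ge_of_dense fun _ hs => primeValue_le hP hu
    (translators_lower hP (sub_le_sub_right h _) (mem_translators_of_primeValue_lt hP hu hs))

lemma primeValue_smul_unit (hP : IsLatticePrime P) (hu : IsOrderUnit u) (c : ℝ) :
    primeValue P u (c • u) = c :=
  le_antisymm (primeValue_le hP hu (mem_translators_of_nonpos hP (by simp)))
    (le_primeValue hP hu (mem_translators_of_nonpos hP (by simp)))

lemma primeValue_sup (hP : IsLatticePrime P) (hu : IsOrderUnit u) (x y : E) :
    primeValue P u (x ⊔ y) = primeValue P u x ⊔ primeValue P u y := by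
  refine le_antisymm (le_of_forall_gt_imp_ge_of_dense fun s hs => primeValue_le hP hu ?_)
    (sup_le (primeValue_mono hP hu le_sup_left) (primeValue_mono hP hu le_sup_right))
  obtain ⟨h1, h2⟩ := sup_lt_iff.1 hs
  rw [sub_eq_add_neg, sup_add, ← sub_eq_add_neg, ← sub_eq_add_neg]
  exact sup_mem_translators hP (mem_translators_of_primeValue_lt hP hu h1)
    (mem_translators_of_primeValue_lt hP hu h2)

lemma primeValue_smul (hP : IsLatticePrime P) (hu : IsOrderUnit u) (c : ℝ) (x : E) :
    primeValue P u (c • x) = c * primeValue P u x := by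
  obtain ⟨M, hM, hx⟩ := hu.exists_abs_le x
  have hle : ∀ c : ℝ, primeValue P u (c • x) ≤ M * |c| := fun c => by
    rw [← primeValue_smul_unit hP hu (M * |c|)]
    refine primeValue_mono hP hu ?_
    rw [mul_comm, mul_smul]
    refine le_trans ?_ (smul_le_smul_of_nonneg_left hx (abs_nonneg c))
    rcases le_total 0 c with h | h
    · rw [abs_of_nonneg h]
      exact smul_le_smul_of_nonneg_left (le_abs_self x) h
    · rw [abs_of_nonpos h, ← neg_smul_neg c x]
      exact smul_le_smul_of_nonneg_left (neg_le_abs x) (neg_nonneg.2 h)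
  let F : ℝ →+ ℝ := AddMonoidHom.mk' (fun c => primeValue P u (c • x)) fun a b => by
    rw [add_smul, primeValue_add hP hu]
  have hF : Continuous F := AddMonoidHomClass.continuous_of_bound F M fun c => by
    rw [Real.norm_eq_abs, Real.norm_eq_abs, abs_le']
    refine ⟨hle c, ?_⟩
    rw [← map_neg F c, ← abs_neg c]
    exact hle (-c)
  have := map_real_smul F hF c 1
  simpa [F] using this

/-- The functional attached to a lattice prime, as a linear map. -/
noncomputable def primeFunctional (hP : IsLatticePrime P) (hu : IsOrderUnit u) : E →ₗ[ℝ] ℝ where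
  toFun := primeValue P u
  map_add' := primeValue_add hP hu
  map_smul' := primeValue_smul hP hu

lemma primeFunctional_le_of_mem_of_notMem (hP : IsLatticePrime P) (hu : IsOrderUnit u)
    (hx : x ∈ P) (hy : y ∉ P) : primeFunctional hP hu x ≤ primeFunctional hP hu y := by
  rw [← sub_nonpos, ← map_sub]
  refine primeValue_le hP hu ?_
  rw [zero_smul, sub_zero]
  refine (mem_translators_or_neg_mem hP (y - x)).elim (fun h => absurd (h x hx) ?_) fun h => ?_
  · rwa [add_sub_cancel]
  · rwa [neg_sub] at h

/-- If the functional of `P` is negative at `x` then all large multiples of `x` lie in `P`; if the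
functional of `Q` is positive at `x` then all large multiples lie outside `Q`. -/
lemma primeFunctional_nonpos_of_subset (hP : IsLatticePrime P) (hQ : IsLatticePrime Q)
    (hu : IsOrderUnit u) (h : P ⊆ Q) (hx : primeFunctional hP hu x < 0) :
    primeFunctional hQ hu x ≤ 0 := by
  by_contra! hx'
  obtain ⟨f, hf⟩ := hP.nonempty
  obtain ⟨g, hg⟩ := hQ.exists_notMem
  obtain ⟨n, hn⟩ := exists_nat_gt (primeFunctional hP hu f / primeFunctional hP hu x)
  obtain ⟨m, hm⟩ := exists_nat_gt (primeFunctional hQ hu g / primeFunctional hQ hu x)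
  rw [div_lt_iff₀ hx'] at hm
  rw [div_lt_iff_of_neg hx] at hn
  have hP' : ((n + m : ℕ) : ℝ) • x ∈ P := by
    by_contra hc
    have := primeFunctional_le_of_mem_of_notMem hP hu hf hc
    rw [map_smul, smul_eq_mul] at this
    push_cast at this
    nlinarith [mul_nonpos_of_nonneg_of_nonpos (Nat.cast_nonneg (α := ℝ) m) hx.le]
  have := primeFunctional_le_of_mem_of_notMem hQ hu (h hP') hg
  rw [map_smul, smul_eq_mul] at this
  push_cast at this
  nlinarith [mul_nonneg (Nat.cast_nonneg (α := ℝ) n) hx'.le]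

lemma primeFunctional_le_of_subset (hP : IsLatticePrime P) (hQ : IsLatticePrime Q)
    (hu : IsOrderUnit u) (h : P ⊆ Q) (x : E) :
    primeFunctional hQ hu x ≤ primeFunctional hP hu x := by
  refine le_of_forall_gt_imp_ge_of_dense fun s hs => ?_
  have hQu : primeFunctional hQ hu (s • u) = s := primeValue_smul_unit hQ hu s
  have hPu : primeFunctional hP hu (s • u) = s := primeValue_smul_unit hP hu s
  have := primeFunctional_nonpos_of_subset (x := x - s • u) hP hQ hu h
    (by rw [map_sub, hPu]; linarith)
  rw [map_sub, hQu] at this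
  linarith

/-- Comparable lattice primes have the same functional. -/
lemma primeFunctional_eq_of_subset (hP : IsLatticePrime P) (hQ : IsLatticePrime Q)
    (hu : IsOrderUnit u) (h : P ⊆ Q) : primeFunctional hP hu = primeFunctional hQ hu := by
  ext x
  refine le_antisymm ?_ (primeFunctional_le_of_subset hP hQ hu h x)
  have := primeFunctional_le_of_subset hP hQ hu h (-x)
  rw [map_neg, map_neg] at this
  linarith

end OrderUnit

/-! ### The functionals attached to the points of `K` -/

section PointFunctional

open Filter Topology

variable {E K : Type*} [Lattice E] [TopologicalSpace K]

/-- The elements whose image under `e` is at most `t` at the point `k`. -/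
def sublevel (e : E ≃o C(K, ℝ)) (k : K) (t : ℝ) : Set E := {x | e x k ≤ t}

lemma isLatticePrime_sublevel (e : E ≃o C(K, ℝ)) (k : K) (t : ℝ) :
    IsLatticePrime (sublevel e k t) where
  lower h hy := le_trans (e.monotone h k) hy
  sup_mem {x y} hx hy := by
    change e (x ⊔ y) k ≤ t
    rw [e.map_sup, ContinuousMap.sup_apply]
    exact sup_le hx hy
  mem_or_mem {x y} h := by
    change e (x ⊓ y) k ≤ t at h
    rw [e.map_inf, ContinuousMap.inf_apply] at h
    exact inf_le_iff.1 h
  nonempty := ⟨e.symm (ContinuousMap.const K t), by simp [sublevel]⟩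
  exists_notMem := ⟨e.symm (ContinuousMap.const K (t + 1)), by simp [sublevel]⟩

variable [AddCommGroup E] [IsOrderedAddMonoid E] [Module ℝ E] [IsOrderedModule ℝ E]
  (e : E ≃o C(K, ℝ)) {u : E} (hu : IsOrderUnit u)

/-- The functional on `E` attached to a point `k`, defined through the level `0` at `k`; every other
level gives the same functional, see `primeFunctional_sublevel`. -/
noncomputable def pointFunctional (k : K) : E →ₗ[ℝ] ℝ :=
  primeFunctional (isLatticePrime_sublevel e k 0) hu

lemma primeFunctional_sublevel (k : K) (t : ℝ) :
    primeFunctional (isLatticePrime_sublevel e k t) hu = pointFunctional e hu k := by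
  rcases le_total t 0 with h | h
  · exact primeFunctional_eq_of_subset _ _ hu fun _ hx => le_trans hx h
  · exact (primeFunctional_eq_of_subset _ _ hu fun _ hx => le_trans hx h).symm

lemma pointFunctional_smul_unit (k : K) (c : ℝ) : pointFunctional e hu k (c • u) = c :=
  primeValue_smul_unit (isLatticePrime_sublevel e k 0) hu c

lemma pointFunctional_mono (k : K) {x y : E} (h : x ≤ y) :
    pointFunctional e hu k x ≤ pointFunctional e hu k y :=
  primeValue_mono (isLatticePrime_sublevel e k 0) hu h

lemma pointFunctional_sup (k : K) (x y : E) :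
    pointFunctional e hu k (x ⊔ y) = pointFunctional e hu k x ⊔ pointFunctional e hu k y :=
  primeValue_sup (isLatticePrime_sublevel e k 0) hu x y

/-- The order of the values at `k` is, up to ties, that of the point functionals at `k`. -/
lemma pointFunctional_le_of_apply_lt {k : K} {x y : E} (h : e x k < e y k) :
    pointFunctional e hu k x ≤ pointFunctional e hu k y := by
  rw [← primeFunctional_sublevel e hu k (e x k)]
  exact primeFunctional_le_of_mem_of_notMem _ hu (le_refl (e x k)) h.not_ge

/-- The point functionals together determine the order: if they are all positive at `x`, then
translation by `-x` preserves every sublevel, so it decreases every element. -/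
lemma nonneg_of_forall_pointFunctional_pos {x : E} (h : ∀ k, 0 < pointFunctional e hu k x) :
    0 ≤ x := by
  have key : e (0 + -x) ≤ e 0 := fun k => by
    have hP := isLatticePrime_sublevel e k (e 0 k)
    have hx : 0 < primeFunctional hP hu x := by
      rw [primeFunctional_sublevel e hu k]; exact h k
    have := mem_translators_of_lt_primeValue hP hu hx
    rw [zero_smul, zero_sub] at this
    exact this 0 (le_refl (e 0 k))
  simpa using e.le_iff_le.1 key

/-- Near a point where the functional is negative at `x`, comparing `n • x` with an element whose
image exceeds that of `0` by `1` bounds the functionals by a multiple of `1 / n`. -/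
lemma eventually_pointFunctional_lt {k : K} {x : E} (hx : pointFunctional e hu k x < 0) {ε : ℝ}
    (hε : 0 < ε) : ∀ᶠ l in 𝓝 k, pointFunctional e hu l x < ε := by
  set g : E := e.symm (e 0 + ContinuousMap.const K 1) with hg
  obtain ⟨M, hM⟩ := hu.exists_le g
  obtain ⟨n, hn⟩ := exists_nat_gt (M / ε)
  rw [div_lt_iff₀ hε] at hn
  have hn0 : (0 : ℝ) < n + 1 := by positivity
  have h0 : e (((n : ℝ) + 1) • x) k ≤ e 0 k := by
    by_contra! hc
    have := pointFunctional_le_of_apply_lt e hu hc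
    rw [map_zero, map_smul, smul_eq_mul] at this
    exact absurd this (mul_neg_of_pos_of_neg hn0 hx).not_ge
  have h1 : e (((n : ℝ) + 1) • x) k < e g k := by
    rw [hg, OrderIso.apply_symm_apply, ContinuousMap.add_apply, ContinuousMap.const_apply]
    linarith
  filter_upwards [(e _).continuous.continuousAt.eventually_lt (e g).continuous.continuousAt h1]
    with l hl
  have h2 := (pointFunctional_le_of_apply_lt e hu hl).trans (pointFunctional_mono e hu l hM)
  rw [pointFunctional_smul_unit, map_smul, smul_eq_mul] at h2
  by_contra! hc
  nlinarith [mul_le_mul_of_nonneg_left hc hn0.le]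

lemma eventually_pointFunctional_lt_add (k : K) (x : E) {ε : ℝ} (hε : 0 < ε) :
    ∀ᶠ l in 𝓝 k, pointFunctional e hu l x < pointFunctional e hu k x + ε := by
  have h := eventually_pointFunctional_lt e hu (k := k)
    (x := x - (pointFunctional e hu k x + ε / 2) • u)
    (by rw [map_sub, pointFunctional_smul_unit]; linarith) (half_pos hε)
  filter_upwards [h] with l hl
  rw [map_sub, pointFunctional_smul_unit] at hl
  linarith

lemma continuous_pointFunctional (x : E) : Continuous fun k => pointFunctional e hu k x := by
  rw [continuous_iff_continuousAt]
  intro k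
  rw [ContinuousAt, Metric.tendsto_nhds]
  intro ε hε
  filter_upwards [eventually_pointFunctional_lt_add e hu k x hε,
    eventually_pointFunctional_lt_add e hu k (-x) hε] with l h1 h2
  rw [map_neg, map_neg] at h2
  rw [Real.dist_eq, abs_lt]
  constructor <;> linarith

/-- Point functionals at different points differ: a continuous function that is large at `k` and
small at `l` corresponds to an element with value at least `1` at `k` and at most `0` at `l`. -/
lemma exists_pointFunctional_ne [CompactSpace K] [T2Space K] {k l : K} (h : k ≠ l) :
    ∃ a, pointFunctional e hu k a ≠ pointFunctional e hu l a := by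
  obtain ⟨w, hwk, hwl, -⟩ := exists_continuous_zero_one_of_isClosed (isClosed_singleton (x := k))
    (isClosed_singleton (x := l)) (by simpa using h)
  have hwk : w k = 0 := hwk rfl
  have hwl : w l = 1 := hwl rfl
  set p := e u k + 1
  set q := e 0 l - 1
  set a := e.symm (ContinuousMap.const K p + (q - p) • w) with ha
  have hak : e u k < e a k := by simp [ha, hwk, p]
  have hal : e a l < e 0 l := by simp [ha, hwl, q]
  have h1 := pointFunctional_le_of_apply_lt e hu hak
  have h2 := pointFunctional_le_of_apply_lt e hu hal
  have h3 := pointFunctional_smul_unit e hu k 1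
  rw [one_smul] at h3
  rw [map_zero] at h2
  have hlt : pointFunctional e hu l a < pointFunctional e hu k a := by linarith
  exact ⟨a, hlt.ne'⟩

/-- The representation of `E` in `C(K, ℝ)` by the point functionals. -/
noncomputable def representation : E →ₗ[ℝ] C(K, ℝ) where
  toFun x := ⟨fun k => pointFunctional e hu k x, continuous_pointFunctional e hu x⟩
  map_add' x y := by ext k; simp
  map_smul' c x := by ext k; simp

lemma representation_apply (x : E) (k : K) :
    representation e hu x k = pointFunctional e hu k x := rfl

lemma representation_sup (x y : E) :
    representation e hu (x ⊔ y) = representation e hu x ⊔ representation e hu y := by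
  ext k
  exact pointFunctional_sup e hu k x y

lemma representation_abs (x : E) : representation e hu |x| = |representation e hu x| := by
  rw [abs, representation_sup, map_neg, abs]

end PointFunctional

/-! ### Order units and representations of Banach lattices -/

section BanachLattice

open Filter Topology

variable {E K : Type*} [NormedAddCommGroup E] [NormedSpace ℝ E] [Lattice E] [IsOrderedAddMonoid E]
  [IsOrderedModule ℝ E] [HasSolidNorm E]

/-- A Banach lattice with a countable cofinal set has an order unit, namely a convergent sum of
positive multiples of the elements of that set. -/
lemma exists_isOrderUnit [CompleteSpace E] (v : ℕ → E) (hv : ∀ x, ∃ n, x ≤ v n) :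
    ∃ u : E, IsOrderUnit u := by
  set c : ℕ → ℝ := fun n => (1 / 2) ^ n * (1 + ‖v n‖)⁻¹
  have hc : ∀ n, 0 < c n := fun n => by positivity
  have hnn : ∀ n, 0 ≤ c n • |v n| := fun n => smul_nonneg (hc n).le (abs_nonneg _)
  have hsum : Summable fun n => c n • |v n| := by
    refine Summable.of_norm_bounded summable_geometric_two fun n => ?_
    rw [norm_smul, norm_abs_eq_norm, Real.norm_of_nonneg (hc n).le, mul_assoc]
    refine mul_le_of_le_one_right (by positivity) ?_
    rw [inv_mul_le_one₀ (by positivity)]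
    linarith
  refine ⟨∑' n, c n • |v n|, tsum_nonneg hnn, fun x => ?_⟩
  obtain ⟨n, hn⟩ := hv x
  refine ⟨(c n)⁻¹, (hn.trans (le_abs_self _)).trans ?_⟩
  have := smul_le_smul_of_nonneg_left (hsum.le_tsum n fun m _ => hnn m) (inv_nonneg.2 (hc n).le)
  rwa [inv_smul_smul₀ (hc n).ne'] at this

variable [TopologicalSpace K] (e : E ≃o C(K, ℝ)) {u : E} (hu : IsOrderUnit u)

lemma nonneg_of_representation_nonneg {x : E} (h : 0 ≤ representation e hu x) : 0 ≤ x := by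
  -- The norm makes `E` Archimedean, so it suffices to treat `x + ε • u` for positive `ε`.
  have hlim : Tendsto (fun ε : ℝ => x + ε • u) (𝓝[>] 0) (𝓝 (x + (0 : ℝ) • u)) :=
    ((continuous_const.add (continuous_id.smul continuous_const)).tendsto 0).mono_left
      nhdsWithin_le_nhds
  rw [zero_smul, add_zero] at hlim
  refine ge_of_tendsto hlim ?_
  filter_upwards [self_mem_nhdsWithin] with ε hε
  refine nonneg_of_forall_pointFunctional_pos e hu fun k => ?_
  rw [map_add, pointFunctional_smul_unit]
  exact add_pos_of_nonneg_of_pos (h k) hε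

lemma representation_injective : Function.Injective (representation e hu) := by
  refine (injective_iff_map_eq_zero _).2 fun x hx => le_antisymm ?_ ?_
  · rw [← neg_nonneg]
    exact nonneg_of_representation_nonneg e hu (by rw [map_neg, hx, neg_zero])
  · exact nonneg_of_representation_nonneg e hu hx.ge

/-- The representation is an isometry for the gauge of the order unit. -/
lemma norm_representation_le_iff [CompactSpace K] {x : E} {c : ℝ} (hc : 0 ≤ c) :
    ‖representation e hu x‖ ≤ c ↔ |x| ≤ c • u := by
  rw [ContinuousMap.norm_le _ hc]
  constructor
  · intro h
    rw [← sub_nonneg]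
    refine nonneg_of_representation_nonneg e hu fun k => ?_
    have := h k
    rw [map_sub, representation_abs]
    change 0 ≤ representation e hu (c • u) k - |representation e hu x k|
    rw [representation_apply e hu (c • u), pointFunctional_smul_unit]
    exact sub_nonneg.2 this
  · intro h k
    have := pointFunctional_mono e hu k h
    rw [pointFunctional_smul_unit, ← representation_apply, representation_abs] at this
    exact this

lemma norm_le_norm_representation_mul [CompactSpace K] (x : E) :
    ‖x‖ ≤ ‖representation e hu x‖ * ‖u‖ := by
  have h := (norm_representation_le_iff e hu (norm_nonneg _)).1 (le_refl ‖representation e hu x‖)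
  rw [← norm_norm (representation e hu x), ← norm_smul]
  exact norm_le_norm_of_abs_le_abs (h.trans (le_abs_self _))

lemma isClosed_range_representation [CompactSpace K] [CompleteSpace E] :
    IsClosed (range (representation e hu)) := by
  refine isClosed_of_closure_subset fun f hf => ?_
  obtain ⟨y, hy, hyf⟩ := mem_closure_iff_seq_limit.1 hf
  choose x hx using hy
  obtain rfl : (fun n => representation e hu (x n)) = y := funext hx
  have hS := Metric.cauchySeq_iff.1 hyf.cauchySeq
  have hcauchy : CauchySeq x := by
    refine Metric.cauchySeq_iff.2 fun ε hε => ?_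
    obtain ⟨N, hN⟩ := hS (ε / (‖u‖ + 1)) (by positivity)
    refine ⟨N, fun m hm n hn => ?_⟩
    have h := hN m hm n hn
    rw [dist_eq_norm, ← map_sub, lt_div_iff₀ (by positivity)] at h
    rw [dist_eq_norm]
    have := norm_le_norm_representation_mul e hu (x m - x n)
    nlinarith [norm_nonneg (representation e hu (x m - x n))]
  obtain ⟨z, hz⟩ := cauchySeq_tendsto_of_complete hcauchy
  refine ⟨z, tendsto_nhds_unique (Metric.tendsto_atTop.2 fun ε hε => ?_) hyf⟩
  -- The bounds `|x m - x n| ≤ (ε / 2) • u` pass to the limit in `m`, as the order is closed.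
  obtain ⟨N, hN⟩ := hS (ε / 2) (half_pos hε)
  refine ⟨N, fun n hn => lt_of_le_of_lt ?_ (half_lt_self hε)⟩
  rw [dist_eq_norm, ← map_sub, norm_representation_le_iff e hu (half_pos hε).le]
  have habs : Continuous fun w : E => |x n - w| := by
    unfold abs
    fun_prop
  refine le_of_tendsto ((habs.tendsto z).comp hz) ?_
  filter_upwards [eventually_ge_atTop N] with m hm
  have h := (hN n hn m hm).le
  rwa [dist_eq_norm, ← map_sub, norm_representation_le_iff e hu (half_pos hε).le] at h

lemma representation_surjective [CompactSpace K] [T2Space K] [CompleteSpace E] :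
    Function.Surjective (representation e hu) := by
  rw [← range_eq_univ, ← (isClosed_range_representation e hu).closure_eq]
  refine ContinuousMap.sublattice_closure_eq_top _ ⟨_, mem_range_self 0⟩ ?_ ?_ ?_
  · rintro _ ⟨x, rfl⟩ _ ⟨y, rfl⟩
    refine ⟨-(-x ⊔ -y), ?_⟩
    rw [map_neg, representation_sup, map_neg, map_neg, neg_sup, neg_neg, neg_neg]
  · rintro _ ⟨x, rfl⟩ _ ⟨y, rfl⟩
    exact ⟨x ⊔ y, representation_sup e hu x y⟩
  · intro v k l
    rcases eq_or_ne k l with rfl | hkl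
    · refine ⟨_, mem_range_self (v k • u), ?_, ?_⟩ <;>
        rw [representation_apply, pointFunctional_smul_unit]
    · obtain ⟨a, ha⟩ := exists_pointFunctional_ne e hu hkl
      have ha' := sub_ne_zero.2 ha
      -- The combination of `a` and `u` that interpolates `v` at the two points.
      set α := (v k - v l) / (pointFunctional e hu k a - pointFunctional e hu l a) with hα
      refine ⟨_, mem_range_self (α • a + (v k - α * pointFunctional e hu k a) • u), ?_, ?_⟩
      · rw [representation_apply, map_add, map_smul, pointFunctional_smul_unit, smul_eq_mul]
        ring
      · rw [representation_apply, map_add, map_smul, pointFunctional_smul_unit, smul_eq_mul, hα]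
        field_simp
        ring

end BanachLattice

theorem theorem1 {E K : Type*}
    [NormedAddCommGroup E] [NormedSpace ℝ E] [CompleteSpace E]
    [Lattice E] [IsOrderedAddMonoid E] [IsOrderedModule ℝ E] [HasSolidNorm E]
    [TopologicalSpace K] [CompactSpace K] [T2Space K]
    (hT : ∃ T : E → C(K, ℝ), Function.Bijective T ∧ ∀ x y : E, y ≤ x ↔ T y ≤ T x) :
    ∃ S : E ≃ₗ[ℝ] C(K, ℝ), ∀ x : E, S |x| = |S x| := by
  obtain ⟨T, hT, hle⟩ := hT
  let e : E ≃o C(K, ℝ) := ⟨Equiv.ofBijective T hT, fun {a b} => (hle b a).symm⟩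
  obtain ⟨u, hu⟩ := exists_isOrderUnit (fun n : ℕ => e.symm (ContinuousMap.const K (n : ℝ)))
    fun x => by
      obtain ⟨n, hn⟩ := exists_nat_ge ‖e x‖
      refine ⟨n, (e.le_symm_apply).2 fun k => ?_⟩
      exact ((le_abs_self _).trans ((e x).norm_coe_le_norm k)).trans hn
  exact ⟨LinearEquiv.ofBijective (representation e hu)
    ⟨representation_injective e hu, representation_surjective e hu⟩, representation_abs e hu⟩
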